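/- Let $\mathcal N=\{1,\dots,n\}$ be a set of products, $\mathcal S$ a collection of assortments (subsets of $\mathcal N$), and $\mathcal I_{\mathcal S}=\{(i,S): S\in\mathcal S,\ i\in S\}$. Let $\boldsymbol p=(p_{i,S})_{(i,S)\in\mathcal I_{\mathcal S}}$ be choice data, i.e. $p_{i,S}\ge 0$ and $\sum_{i\in S}p_{i,S}=1$ for every $S\in\mathcal S$. A marginal distribution model (MDM) consists of deterministic utilities $\nu_1,\dots,\nu_n\in\mathbb R$ and of laws $F_1,\dots,F_n$ on $\mathbb R$ that are absolutely continuous, have finite mean, and have distribution functions that are strictly increasing on their supports. For an assortment $S$, let $\theta^*_S$ attain the maximum of $\mathbb E_\theta[\max_{i\in S}(\nu_i+\tilde\epsilon_i)]$ over all joint laws $\theta$ of $(\tilde\epsilon_1,\dots,\tilde\epsilon_n)$ with marginals $F_1,\dots,F_n$; the choice probabilities of the MDM are $\mathbb P_{\theta^*_S}(i=\arg\max_{j\in S}(\nu_j+\tilde\epsilon_j))$, $i\in S$. Let $\mathcal P_{\mathrm{mdm}}(\mathcal S)\subseteq\mathbb R^{\mathcal I_{\mathcal S}}$ be the set of vectors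 $(x_{i,S})$ that are the choice probabilities of some MDM (the same MDM for all $S\in\mathcal S$). For each $S\in\mathcal S$ let $x_S\mapsto\mathrm{loss}_S(p_S,x_S)\in[0,\infty]$ be convex and continuous on the probability simplex over $S$. The limit of MDM is $$\mathcal L(\boldsymbol p)=\inf\Big\{\sum_{S\in\mathcal S}\mathrm{loss}_S(p_S,x_S)\;:\;\boldsymbol x\in\mathcal P_{\mathrm{mdm}}(\mathcal S)\Big\}.$$ Suppose that $\mathcal S$ is nested ($\mathcal S=\{S_1,\dots,S_m\}$ with $S_1\subset S_2\subset\dots\subset S_m$) or laminar (any two distinct members are disjoint or related by containment). Then $\mathcal L(\boldsymbol p)$ equals the value of the convex program $$\min_{\boldsymbol x}\ \sum_{S\in\mathcal S}\mathrm{loss}_S(p_S,x_S)\quad\text{s.t.}\quad x_{i,S}\ge x_{i,T}\ \text{ if } S\subset T,\ (i,S),(i,T)\in\mathcal I_{\mathcal S};\quad \sum_{i\in S}x_{i,S}=1,\ S\in\mathcal S;\quad x_{i,S}\ge 0,\ (i,S)\in\mathcal I_{\mathcal S},$$ and the minimum is attained. The program has at most $n|\mathcal S|$ (so $O(n|\mathcal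 S|)$) continuous variables and at most $2n|\mathcal S|^2$ (so $O(n|\mathcal S|^2)$) linear constraints, whose coefficients and right-hand sides lie in $\{-1,0,1\}$. Moreover $\mathcal L(\boldsymbol p)$ is also the attained minimum of the same objective over all pairs $(\boldsymbol x,\boldsymbol\lambda)$, $\boldsymbol\lambda\in\mathbb R^{\mathcal S}$, that satisfy the last two groups of constraints and $x_{i,S}\ge x_{i,T}$ whenever $\lambda_S\le\lambda_T$, $(i,S),(i,T)\in\mathcal I_{\mathcal S}$. -/

import Mathlib

open MeasureTheory ProbabilityTheory
open scoped NNReal ENNReal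

noncomputable section

/-! ### Assortment collections and choice probability vectors -/

/-- The product-assortment pairs `(S, i)` with `S ∈ 𝒮` and `i ∈ S`. -/
abbrev PairIdx {n : ℕ} (𝒮 : Finset (Finset (Fin n))) : Type :=
  Σ S : {S : Finset (Fin n) // S ∈ 𝒮}, {i : Fin n // i ∈ S.1}

/-- The block `x_S = (x_{i,S} : i ∈ S)` of a vector `x` indexed by product-assortment pairs. -/
def block {n : ℕ} {𝒮 : Finset (Finset (Fin n))} (x : PairIdx 𝒮 → ℝ)
    (S : {S : Finset (Fin n) // S ∈ 𝒮}) : {i : Fin n // i ∈ S.1} → ℝ :=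
  fun i => x ⟨S, i⟩

/-- `p` is a collection of choice probabilities: for every assortment `S ∈ 𝒮`, the block `p_S` is
non-negative and sums to one. -/
def IsChoiceData {n : ℕ} {𝒮 : Finset (Finset (Fin n))} (p : PairIdx 𝒮 → ℝ) : Prop :=
  ∀ S : {S : Finset (Fin n) // S ∈ 𝒮}, block p S ∈ stdSimplex ℝ {i : Fin n // i ∈ S.1}

/-- Nested: the assortments can be indexed as `S_1 ⊂ S_2 ⊂ … ⊂ S_m`. -/
def IsNested {n : ℕ} (𝒮 : Finset (Finset (Fin n))) : Prop :=
  ∃ (m : ℕ) (s : Fin m → Finset (Fin n)), StrictMono s ∧ ∀ S, S ∈ 𝒮 ↔ ∃ k, s k = S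

/-- Laminar: any two distinct assortments are related by containment or disjoint. -/
def IsLaminar {n : ℕ} (𝒮 : Finset (Finset (Fin n))) : Prop :=
  ∀ S ∈ 𝒮, ∀ T ∈ 𝒮, S ≠ T → S ⊂ T ∨ T ⊂ S ∨ S ∩ T = ∅

/-! ### The marginal distribution model -/

/-- The data of a marginal distribution model on `n` products: deterministic utilities `ν_i`, and
the laws of the random terms `ε_i`, each of which is an absolutely continuous probability
distribution with finite mean whose distribution function is strictly increasing on its support. -/
structure MDMData (n : ℕ) where
  ν : Fin n → ℝ
  law : Fin n → Measure ℝ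
  isProbabilityMeasure_law : ∀ i, IsProbabilityMeasure (law i)
  absolutelyContinuous_law : ∀ i, law i ≪ volume
  strictMonoOn_cdf : ∀ i, StrictMonoOn (fun t => cdf (law i) t) (law i).support
  integrable_law : ∀ i, Integrable (fun t : ℝ => t) (law i)

/-- The joint distributions `θ` of `(ε_1, …, ε_n)` with the prescribed marginals. -/
def MDMData.jointLaws {n : ℕ} (M : MDMData n) : Set (Measure (Fin n → ℝ)) :=
  {θ | IsProbabilityMeasure θ ∧ ∀ i, θ.map (fun ε => ε i) = M.law i}

/-- The expected maximal utility `E_θ [max_{i ∈ S} (ν_i + ε_i)]` (for nonempty `S`). -/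
def MDMData.expectedMax {n : ℕ} (M : MDMData n) (S : Finset (Fin n))
    (θ : Measure (Fin n → ℝ)) : ℝ :=
  ∫ ε, ⨆ i : {i : Fin n // i ∈ S}, (M.ν i.1 + ε i.1) ∂θ

/-- `θ` attains the maximum of the expected maximal utility over `S` among all joint
distributions with the prescribed marginals. -/
def MDMData.IsExtremal {n : ℕ} (M : MDMData n) (S : Finset (Fin n))
    (θ : Measure (Fin n → ℝ)) : Prop :=
  θ ∈ M.jointLaws ∧ ∀ θ' ∈ M.jointLaws, M.expectedMax S θ' ≤ M.expectedMax S θ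

/-- The probability under `θ` that product `i` is the utility maximizer in `S`. -/
def MDMData.choiceProb {n : ℕ} (M : MDMData n) (S : Finset (Fin n))
    (θ : Measure (Fin n → ℝ)) (i : Fin n) : ℝ :=
  θ.real {ε | ∀ j ∈ S, j ≠ i → M.ν j + ε j < M.ν i + ε i}

/-- The choice probability vectors over `𝒮` that are representable by some MDM. The utilities and
the marginals are common to all assortments; the extremal joint distribution depends on the
assortment. -/
def mdmRepresentable {n : ℕ} (𝒮 : Finset (Finset (Fin n))) : Set (PairIdx 𝒮 → ℝ) :=
  {x | ∃ M : MDMData n, ∀ S : {S : Finset (Fin n) // S ∈ 𝒮}, ∃ θ : Measure (Fin n → ℝ),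
    M.IsExtremal S.1 θ ∧ ∀ i, block x S i = M.choiceProb S.1 θ i.1}

/-! ### Losses and the limit of MDM -/

/-- Losses on single assortments: `loss S p_S x_S ∈ [0, ∞]`. -/
abbrev LossFamily (n : ℕ) : Type :=
  ∀ S : Finset (Fin n), ({i : Fin n // i ∈ S} → ℝ) → ({i : Fin n // i ∈ S} → ℝ) → ℝ≥0∞

/-- The total loss `∑_{S ∈ 𝒮} loss(p_S, x_S)`. -/
def totalLoss {n : ℕ} {𝒮 : Finset (Finset (Fin n))} (loss : LossFamily n)
    (p x : PairIdx 𝒮 → ℝ) : ℝ≥0∞ :=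
  ∑ S : {S : Finset (Fin n) // S ∈ 𝒮}, loss S.1 (block p S) (block x S)

/-- The limit of MDM: the infimum of the loss over all MDM-representable vectors. -/
def mdmLimit {n : ℕ} {𝒮 : Finset (Finset (Fin n))} (loss : LossFamily n)
    (p : PairIdx 𝒮 → ℝ) : ℝ≥0∞ :=
  ⨅ x ∈ mdmRepresentable 𝒮, totalLoss loss p x

/-- The feasible pairs `(x, lam)` of the general program for the limit: `x_{i,S} ≥ x_{i,T}` whenever
`lam_S ≤ lam_T`, together with the simplex constraints. -/
def rankingFeasible {n : ℕ} (𝒮 : Finset (Finset (Fin n))) :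
    Set ((PairIdx 𝒮 → ℝ) × ({S : Finset (Fin n) // S ∈ 𝒮} → ℝ)) :=
  {q | (∀ a b : PairIdx 𝒮, a.2.1 = b.2.1 → q.2 a.1 ≤ q.2 b.1 → q.1 b ≤ q.1 a) ∧
    (∀ S : {S : Finset (Fin n) // S ∈ 𝒮}, ∑ i : {i : Fin n // i ∈ S.1}, q.1 ⟨S, i⟩ = 1) ∧
    (∀ a : PairIdx 𝒮, 0 ≤ q.1 a)}

/-! ### Linearly constrained programs -/

/-- A linear constraint `∑ a_j x_j ≥ b` or `∑ a_j x_j = b` on real variables `(x_j)_{j ∈ ι}`. -/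
inductive LinConstraint (ι : Type) : Type
  | ge (a : ι → ℝ) (b : ℝ) : LinConstraint ι
  | eq (a : ι → ℝ) (b : ℝ) : LinConstraint ι

namespace LinConstraint

/-- The coefficients of a linear constraint. -/
def coeff {ι : Type} : LinConstraint ι → ι → ℝ
  | ge a _ => a
  | eq a _ => a

/-- The right-hand side of a linear constraint. -/
def rhs {ι : Type} : LinConstraint ι → ℝ
  | ge _ b => b
  | eq _ b => b

/-- `x` satisfies the constraint. -/
def Holds {ι : Type} [Fintype ι] : LinConstraint ι → (ι → ℝ) → Prop
  | ge a b, x => b ≤ ∑ j, a j * x j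
  | eq a b, x => ∑ j, a j * x j = b

end LinConstraint

/-- A minimization program in the real variables `(x_j)_{j ∈ ι}` with a finite list of linear
constraints and an objective with values in `[0, ∞]`. -/
structure LinConstrainedProgram (ι : Type) [Fintype ι] where
  objective : (ι → ℝ) → ℝ≥0∞
  numConstraints : ℕ
  constraint : Fin numConstraints → LinConstraint ι

/-- The feasible region. -/
def LinConstrainedProgram.feasible {ι : Type} [Fintype ι] (P : LinConstrainedProgram ι) :
    Set (ι → ℝ) :=
  {x | ∀ k, (P.constraint k).Holds x}

/-- The program is convex: the feasible region is convex and the objective is convex on it. -/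
def LinConstrainedProgram.IsConvex {ι : Type} [Fintype ι] (P : LinConstrainedProgram ι) : Prop :=
  Convex ℝ P.feasible ∧ ConvexOn ℝ≥0 P.feasible P.objective

/-- `v` is the optimal value of the program, and it is attained. -/
def LinConstrainedProgram.HasMin {ι : Type} [Fintype ι] (P : LinConstrainedProgram ι)
    (v : ℝ≥0∞) : Prop :=
  IsLeast (P.objective '' P.feasible) v

/-! ### The regularity program -/

/-- The pairs `((i,S), (i,T))` of product-assortment pairs with a common product and `S ⊂ T`. -/
abbrev RegularityIdx {n : ℕ} (𝒮 : Finset (Finset (Fin n))) : Type :=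
  {t : PairIdx 𝒮 × PairIdx 𝒮 // t.1.2.1 = t.2.2.1 ∧ t.1.1.1 ⊂ t.2.1.1}

/-- One index for each regularity, each normalization and each non-negativity constraint. -/
abbrev RegularityConstraintIdx {n : ℕ} (𝒮 : Finset (Finset (Fin n))) : Type :=
  RegularityIdx 𝒮 ⊕ ({S : Finset (Fin n) // S ∈ 𝒮} ⊕ PairIdx 𝒮)

/-- The constraints `x_{i,S} - x_{i,T} ≥ 0` for `S ⊂ T`, `∑_{i ∈ S} x_{i,S} = 1`, and
`x_{i,S} ≥ 0`. -/
def regularityConstraint {n : ℕ} (𝒮 : Finset (Finset (Fin n))) :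
    RegularityConstraintIdx 𝒮 → LinConstraint (PairIdx 𝒮)
  | .inl t => .ge (Pi.single t.1.1 1 - Pi.single t.1.2 1) 0
  | .inr (.inl S) => .eq (fun a => if a.1 = S then 1 else 0) 1
  | .inr (.inr a) => .ge (Pi.single a 1) 0

/-- Minimize `∑_{S ∈ 𝒮} loss(p_S, x_S)` subject to the regularity and the simplex constraints. -/
def regularityProgram {n : ℕ} {𝒮 : Finset (Finset (Fin n))} (loss : LossFamily n)
    (p : PairIdx 𝒮 → ℝ) : LinConstrainedProgram (PairIdx 𝒮) where
  objective := totalLoss loss p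
  numConstraints := Fintype.card (RegularityConstraintIdx 𝒮)
  constraint := fun k =>
    regularityConstraint 𝒮 ((Fintype.equivFin (RegularityConstraintIdx 𝒮)).symm k)

end

/-! ### Pathwise duality for the maximum of finitely many reals -/

section Pathwise

variable {ι : Type*} [Fintype ι]

/-! For every level `l`, the maximum of the utilities `z i` over `S` is at most `l + ∑ (z i - l)⁺`.
The expectation of this bound depends on the marginals only, so it dominates the expected maximum
under every coupling. When the exceedance probabilities of `l` over `S` sum to one, a coupling under
which exactly one utility exceeds `l` attains the bound. Attainment forces the choice probabilities
of every extremal law to be these exceedance probabilities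
(`MDMData.IsExtremal.choiceProb_eq_tail`). A model thus gives each assortment with at least two
products a level, and its choice probabilities are the tails at that level.

Tails decrease in the level, and normalization settles the case where the levels of `S ⊂ T` come in
the wrong order. Hence representable vectors are regular (`mdmRepresentable_subset_regularVectors`).

Conversely, let the collection be laminar and take the cardinality of `S` as its level. Distinct
assortments sharing product `i` are comparable by inclusion, so for regular `x` the values `x_{i,S}`
do not increase with the cardinality and extend to a survival function of product `i`. A small
uniform admixture makes it strictly decreasing, as the model requires
(`mixUniform_mem_mdmRepresentable`). Every regular vector is therefore a limit of representable
ones. Continuity of the loss makes the two infima agree, and compactness of the regular set gives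
attainment. -/

lemma sub_le_sum_max_sub_zero (z : ι → ℝ) (l : ℝ) (i : ι) :
    z i - l ≤ ∑ j, max (z j - l) 0 :=
  (le_max_left _ _).trans
    (Finset.single_le_sum (f := fun j => max (z j - l) 0) (fun _ _ => le_max_right _ _)
      (Finset.mem_univ i))

lemma ciSup_le_add_sum_max [Nonempty ι] (z : ι → ℝ) (l : ℝ) :
    ⨆ i, z i ≤ l + ∑ i, max (z i - l) 0 :=
  ciSup_le fun i => by linarith [sub_le_sum_max_sub_zero z l i]

lemma ciSup_eq_add_sum_max (z : ι → ℝ) (l : ℝ) (i : ι) (hi : l < z i)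
    (hj : ∀ j, j ≠ i → z j ≤ l) : ⨆ i, z i = l + ∑ i, max (z i - l) 0 := by
  have hsum : ∑ j, max (z j - l) 0 = z i - l := by
    rw [Finset.sum_eq_single i (fun j _ h => max_eq_right (by linarith [hj j h])) (by simp)]
    exact max_eq_left (by linarith)
  have : Nonempty ι := ⟨i⟩
  refine le_antisymm (ciSup_le_add_sum_max z l) ?_
  rw [hsum]
  linarith [le_ciSup (Set.finite_range z).bddAbove i]

/-- Equality makes the positive part at a maximizer `k` the whole sum, so no other coordinate
exceeds `l`. Since no coordinate equals `l`, exceeding `l` and being the strict maximizer coincide.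
-/
lemma strict_argmax_iff_of_ciSup_eq [Nonempty ι] (z : ι → ℝ) (l : ℝ) (hne : ∀ i, z i ≠ l)
    (h : ⨆ i, z i = l + ∑ i, max (z i - l) 0) (i : ι) :
    (∀ j, j ≠ i → z j < z i) ↔ l < z i := by
  classical
  obtain ⟨k, hk⟩ := exists_eq_ciSup_of_finite (f := z)
  have hsum : ∑ j, max (z j - l) 0 = z k - l := by linarith
  have hnn : ∀ s : Finset ι, 0 ≤ ∑ j ∈ s, max (z j - l) 0 := fun s =>
    Finset.sum_nonneg fun _ _ => le_max_right _ _
  have hkl : l < z k := lt_of_le_of_ne (by linarith [hnn Finset.univ]) (hne k).symm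
  have hrest : ∀ j, j ≠ k → z j < l := by
    intro j hj
    by_contra hcon
    have hjl : l < z j := lt_of_le_of_ne (not_lt.mp hcon) (hne j).symm
    have h2 := Finset.add_sum_erase Finset.univ (fun j => max (z j - l) 0) (Finset.mem_univ k)
    have h3 := Finset.single_le_sum (f := fun j => max (z j - l) 0)
      (fun _ _ => le_max_right _ _) (Finset.mem_erase.2 ⟨hj, Finset.mem_univ j⟩)
    rw [max_eq_left (by linarith)] at h2 h3
    linarith
  constructor
  · intro hi
    by_cases hik : k = i
    · exact hik ▸ hkl
    · exact hkl.trans (hi k hik)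
  · intro hi j hj
    have hik : i = k := by
      by_contra hik
      exact absurd hi (hrest i hik).le.not_gt
    subst hik
    exact (hrest j hj).trans hi

end Pathwise

/-! ### A coupling that partitions -/

lemma measure_smul_cond {Ω : Type*} [MeasurableSpace Ω] (μ : Measure Ω) [IsFiniteMeasure μ]
    (s : Set Ω) : μ s • μ[|s] = μ.restrict s := by
  rw [ProbabilityTheory.cond, smul_smul]
  by_cases h : μ s = 0
  · simp [h, Measure.restrict_eq_zero.2 h]
  · rw [ENNReal.mul_inv_cancel h (measure_ne_top μ s), one_smul]

/-- Sets `A i`, `i ∈ S`, whose `μ i`-probabilities sum to one admit a coupling of the laws `μ i`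
under which almost surely exactly one of the events `x i ∈ A i`, `i ∈ S`, occurs. -/
lemma exists_coupling_partition {ι : Type*} [Fintype ι] {X : ι → Type*}
    [∀ i, MeasurableSpace (X i)] (μ : ∀ i, Measure (X i)) [∀ i, IsProbabilityMeasure (μ i)]
    (S : Finset ι) (A : ∀ i, Set (X i)) (hA : ∀ i, MeasurableSet (A i))
    (hsum : ∑ i ∈ S, μ i (A i) = 1) :
    ∃ θ : Measure (∀ i, X i), IsProbabilityMeasure θ ∧ (∀ i, θ.map (fun x => x i) = μ i) ∧
      ∀ᵐ x ∂θ, ∃ i ∈ S, x i ∈ A i ∧ ∀ j ∈ S, j ≠ i → x j ∉ A j := by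
  classical
  -- The coupling is a mixture: with weight `μ i (A i)`, component `i` draws independent
  -- coordinates, the `i`-th conditioned to lie in its set and the others in `S` conditioned to
  -- avoid theirs.
  let κ : ∀ _ j : ι, Measure (X j) := fun i j =>
    if j = i then (μ j)[|A j] else if j ∈ S then (μ j)[|(A j)ᶜ] else μ j
  -- The components other than `j` have exactly the weight of `(A j)ᶜ`, so the two conditional laws
  -- of coordinate `j` recombine to `μ j`.
  have hcompl : ∀ j ∈ S, ∑ i ∈ S.erase j, μ i (A i) = μ j (A j)ᶜ := by
    intro j hj
    have h1 := Finset.add_sum_erase S (fun i => μ i (A i)) hj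
    have h2 := measure_add_measure_compl (μ := μ j) (hA j)
    rw [measure_univ, ← hsum, ← h1] at h2
    exact ((ENNReal.add_right_inj (measure_ne_top (μ j) (A j))).1 h2).symm
  -- Components of weight zero may condition on null events, but they do not contribute to the
  -- mixture.
  have hκ : ∀ i ∈ S, μ i (A i) ≠ 0 → ∀ j, IsProbabilityMeasure (κ i j) := by
    intro i hi hwi j
    by_cases hji : j = i
    · subst hji
      simpa [κ] using cond_isProbabilityMeasure hwi
    · by_cases hj : j ∈ S
      · have : μ j (A j)ᶜ ≠ 0 := by
          rw [← hcompl j hj]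
          intro h0
          exact hwi (Finset.sum_eq_zero_iff.1 h0 i (Finset.mem_erase.2 ⟨Ne.symm hji, hi⟩))
        simpa [κ, hji, hj] using cond_isProbabilityMeasure this
      · simp only [κ, hji, hj, if_false]
        infer_instance
  let θ : Measure (∀ i, X i) := ∑ i ∈ S, μ i (A i) • Measure.pi (κ i)
  have hmap : ∀ j, θ.map (fun x => x j) = μ j := by
    intro j
    have h1 : θ.map (fun x => x j) = ∑ i ∈ S, μ i (A i) • κ i j := by
      ext s hs
      rw [Measure.map_apply (measurable_pi_apply j) hs]
      simp only [θ, Measure.finsetSum_apply, Measure.smul_apply, smul_eq_mul]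
      refine Finset.sum_congr rfl fun i hi => ?_
      by_cases hwi : μ i (A i) = 0
      · simp [hwi]
      · have := hκ i hi hwi
        rw [← (measurePreserving_eval (κ i) j).measure_preimage hs.nullMeasurableSet]
    rw [h1]
    by_cases hj : j ∈ S
    · rw [← Finset.add_sum_erase S _ hj]
      have h2 : ∑ i ∈ S.erase j, μ i (A i) • κ i j
          = (∑ i ∈ S.erase j, μ i (A i)) • (μ j)[|(A j)ᶜ] := by
        rw [Finset.sum_smul]
        refine Finset.sum_congr rfl fun i hi => ?_
        simp [κ, (Finset.ne_of_mem_erase hi).symm, hj]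
      rw [h2, hcompl j hj, measure_smul_cond]
      simp only [κ, if_true]
      rw [measure_smul_cond]
      exact Measure.restrict_add_restrict_compl (hA j)
    · have h2 : ∑ i ∈ S, μ i (A i) • κ i j = (∑ i ∈ S, μ i (A i)) • μ j := by
        rw [Finset.sum_smul]
        refine Finset.sum_congr rfl fun i hi => ?_
        have : j ≠ i := fun h => hj (h ▸ hi)
        simp [κ, this, hj]
      rw [h2, hsum, one_smul]
  have hprob : IsProbabilityMeasure θ := by
    refine ⟨?_⟩
    simp only [θ, Measure.finsetSum_apply, Measure.smul_apply, smul_eq_mul]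
    rw [← hsum]
    refine Finset.sum_congr rfl fun i hi => ?_
    by_cases hwi : μ i (A i) = 0
    · simp [hwi]
    · have := hκ i hi hwi
      simp
  refine ⟨θ, hprob, hmap, ?_⟩
  rw [ae_iff]
  simp only [θ, Measure.finsetSum_apply, Measure.smul_apply, smul_eq_mul]
  refine Finset.sum_eq_zero fun i hi => ?_
  by_cases hwi : μ i (A i) = 0
  · simp [hwi]
  have := hκ i hi hwi
  have key : ∀ᵐ x ∂Measure.pi (κ i), ∃ i ∈ S, x i ∈ A i ∧ ∀ j ∈ S, j ≠ i → x j ∉ A j := by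
    have hcoord : ∀ j, ∀ᵐ x ∂Measure.pi (κ i),
        (j = i → x j ∈ A j) ∧ (j ∈ S → j ≠ i → x j ∉ A j) := by
      intro j
      refine (measurePreserving_eval (κ i) j).quasiMeasurePreserving.ae
        (p := fun y => (j = i → y ∈ A j) ∧ (j ∈ S → j ≠ i → y ∉ A j)) ?_
      by_cases hji : j = i
      · simp only [κ, hji, if_true]
        subst hji
        filter_upwards [ae_cond_mem (hA j)] with y hy
        simp [hy]
      · by_cases hj : j ∈ S
        · simp only [κ, hji, hj, if_true, if_false]
          filter_upwards [ae_cond_mem (hA j).compl] with y hy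
          exact ⟨fun h => h.elim, fun _ _ => hy⟩
        · simp [hji, hj]
    filter_upwards [ae_all_iff.2 hcoord] with x hx
    exact ⟨i, hi, (hx i).1 rfl, fun j hj hji => (hx j).2 hj hji⟩
  rw [ae_iff] at key
  rw [key, mul_zero]

/-! ### Extremal distributions of a marginal distribution model -/

namespace MDMData

variable {n : ℕ} (M : MDMData n)

/-- The probability that the utility of product `i` exceeds the level `l`. -/
noncomputable def tail (l : ℝ) (i : Fin n) : ℝ :=
  (M.law i).real (Set.Ioi (l - M.ν i))

/-- The dual upper bound `l + ∑_{i ∈ S} E (ν_i + ε_i - l)⁺` on the expected maximal utility. -/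
noncomputable def dualBound (S : Finset (Fin n)) (l : ℝ) : ℝ :=
  l + ∑ i : {i // i ∈ S}, ∫ t, max (M.ν i.1 + t - l) 0 ∂(M.law i.1)

instance (i : Fin n) : IsProbabilityMeasure (M.law i) := M.isProbabilityMeasure_law i

instance (i : Fin n) : NullSingletonClass (M.law i) :=
  ⟨fun _ => M.absolutelyContinuous_law i (measure_singleton _)⟩

variable {M} {S : Finset (Fin n)} {θ : Measure (Fin n → ℝ)}

lemma measurePreserving_of_mem_jointLaws (hθ : θ ∈ M.jointLaws) (i : Fin n) :
    MeasurePreserving (fun ε : Fin n → ℝ => ε i) θ (M.law i) :=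
  ⟨measurable_pi_apply i, hθ.2 i⟩

lemma integrable_max_law (l : ℝ) (i : Fin n) :
    Integrable (fun t => max (M.ν i + t - l) 0) (M.law i) :=
  (((integrable_const _).add (M.integrable_law i)).sub (integrable_const _)).pos_part

lemma integrable_max (hθ : θ ∈ M.jointLaws) (l : ℝ) (i : Fin n) :
    Integrable (fun ε : Fin n → ℝ => max (M.ν i + ε i - l) 0) θ :=
  ((measurePreserving_of_mem_jointLaws hθ i).integrable_comp
    (integrable_max_law l i).aestronglyMeasurable).2 (integrable_max_law l i)

lemma integrable_utility (hθ : θ ∈ M.jointLaws) (i : Fin n) :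
    Integrable (fun ε : Fin n → ℝ => M.ν i + ε i) θ := by
  have := hθ.1
  exact (integrable_const _).add (((measurePreserving_of_mem_jointLaws hθ i).integrable_comp
    (M.integrable_law i).aestronglyMeasurable).2 (M.integrable_law i))

lemma integrable_ciSup (hθ : θ ∈ M.jointLaws) (hS : S.Nonempty) :
    Integrable (fun ε : Fin n → ℝ => ⨆ i : {i // i ∈ S}, (M.ν i.1 + ε i.1)) θ := by
  have : Nonempty {i // i ∈ S} := hS.to_subtype
  refine Integrable.mono'
    (integrable_finsetSum Finset.univ fun (i : {i // i ∈ S}) _ => (integrable_utility hθ i.1).norm)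
    (Measurable.aestronglyMeasurable (by fun_prop)) (Filter.Eventually.of_forall fun ε => ?_)
  obtain ⟨k, hk⟩ := exists_eq_ciSup_of_finite (f := fun i : {i // i ∈ S} => M.ν i.1 + ε i.1)
  rw [← hk]
  exact Finset.single_le_sum (f := fun i : {i // i ∈ S} => ‖M.ν i.1 + ε i.1‖)
    (fun _ _ => norm_nonneg _) (Finset.mem_univ k)

/-- Each summand involves a single coordinate, so the coupling is irrelevant. -/
lemma integral_add_sum_max (hθ : θ ∈ M.jointLaws) (S : Finset (Fin n)) (l : ℝ) :
    ∫ ε, (l + ∑ i : {i // i ∈ S}, max (M.ν i.1 + ε i.1 - l) 0) ∂θ = M.dualBound S l := by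
  have := hθ.1
  rw [integral_add (integrable_const _)
    (integrable_finsetSum _ fun i _ => integrable_max hθ l i.1),
    integral_finsetSum _ fun i _ => integrable_max hθ l i.1]
  simp only [integral_const, probReal_univ, one_smul, dualBound]
  congr 1
  refine Finset.sum_congr rfl fun i _ => ?_
  rw [← hθ.2 i.1, integral_map (measurable_pi_apply _).aemeasurable]
  rw [hθ.2 i.1]
  exact (integrable_max_law l i.1).aestronglyMeasurable

lemma integrable_add_sum_max (hθ : θ ∈ M.jointLaws) (S : Finset (Fin n)) (l : ℝ) :
    Integrable (fun ε : Fin n → ℝ => l + ∑ i : {i // i ∈ S}, max (M.ν i.1 + ε i.1 - l) 0) θ := by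
  have := hθ.1
  exact (integrable_const _).add (integrable_finsetSum _ fun i _ => integrable_max hθ l i.1)

lemma expectedMax_le_dualBound (hθ : θ ∈ M.jointLaws) (hS : S.Nonempty) (l : ℝ) :
    M.expectedMax S θ ≤ M.dualBound S l := by
  have : Nonempty {i // i ∈ S} := hS.to_subtype
  rw [← integral_add_sum_max hθ]
  exact integral_mono (integrable_ciSup hθ hS) (integrable_add_sum_max hθ S l)
    fun ε => ciSup_le_add_sum_max (fun i : {i // i ∈ S} => M.ν i.1 + ε i.1) l

/-- Equal integrals in the pathwise inequality force almost sure equality. Atomless marginals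
exclude utilities equal to `l`, so `strict_argmax_iff_of_ciSup_eq` applies almost surely. -/
lemma choiceProb_eq_tail_of_expectedMax_eq (hθ : θ ∈ M.jointLaws) {l : ℝ}
    (h : M.expectedMax S θ = M.dualBound S l) {i : Fin n} (hi : i ∈ S) :
    M.choiceProb S θ i = M.tail l i := by
  have : Nonempty {i // i ∈ S} := ⟨⟨i, hi⟩⟩
  have hS : S.Nonempty := ⟨i, hi⟩
  rw [← integral_add_sum_max hθ] at h
  have hae := (integral_eq_iff_of_ae_le (integrable_ciSup hθ hS) (integrable_add_sum_max hθ S l)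
    (Filter.Eventually.of_forall
      fun ε => ciSup_le_add_sum_max (fun i : {i // i ∈ S} => M.ν i.1 + ε i.1) l)).1 h
  have hne : ∀ᵐ ε ∂θ, ∀ j, M.ν j + ε j ≠ l := by
    refine ae_all_iff.2 fun j => ?_
    have h0 : ∀ᵐ t ∂M.law j, t ≠ l - M.ν j := by
      simp [ae_iff]
    filter_upwards [(measurePreserving_of_mem_jointLaws hθ j).quasiMeasurePreserving.ae h0]
      with ε hε heq
    exact hε (by linarith)
  have hset : {ε : Fin n → ℝ | ∀ j ∈ S, j ≠ i → M.ν j + ε j < M.ν i + ε i} =ᵐ[θ]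
      (fun ε : Fin n → ℝ => ε i) ⁻¹' Set.Ioi (l - M.ν i) := by
    filter_upwards [hae, hne] with ε h1 h2
    have h3 := strict_argmax_iff_of_ciSup_eq (fun i : {i // i ∈ S} => M.ν i.1 + ε i.1) l
      (fun i => h2 i.1) h1 ⟨i, hi⟩
    refine propext ?_
    change (∀ j ∈ S, j ≠ i → M.ν j + ε j < M.ν i + ε i) ↔ l - M.ν i < ε i
    rw [sub_lt_iff_lt_add', ← h3]
    simp only [Subtype.forall, ne_eq, Subtype.mk.injEq]
  rw [choiceProb, tail, measureReal_congr hset]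
  exact (measurePreserving_of_mem_jointLaws hθ i).measureReal_preimage
    measurableSet_Ioi.nullMeasurableSet

lemma exists_expectedMax_eq_dualBound {l : ℝ} (hl : ∑ i ∈ S, M.tail l i = 1) :
    ∃ θ ∈ M.jointLaws, M.expectedMax S θ = M.dualBound S l := by
  have hsum : ∑ i ∈ S, M.law i (Set.Ioi (l - M.ν i)) = 1 := by
    rw [← ENNReal.toReal_eq_one_iff, ENNReal.toReal_sum fun i _ => measure_ne_top _ _]
    exact hl
  obtain ⟨θ, hp, hmarg, hae⟩ := exists_coupling_partition M.law S
    (fun i => Set.Ioi (l - M.ν i)) (fun _ => measurableSet_Ioi) hsum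
  have hθ : θ ∈ M.jointLaws := ⟨hp, hmarg⟩
  refine ⟨θ, hθ, ?_⟩
  rw [← integral_add_sum_max hθ]
  refine integral_congr_ae ?_
  filter_upwards [hae] with ε ⟨i, hi, hgt, hle⟩
  refine ciSup_eq_add_sum_max (fun i : {i // i ∈ S} => M.ν i.1 + ε i.1) l ⟨i, hi⟩ ?_ ?_
  · simp only [Set.mem_Ioi] at hgt
    simp only
    linarith
  · rintro ⟨j, hj⟩ hji
    have := hle j hj (fun h => hji (Subtype.ext h))
    simp only [Set.mem_Ioi, not_lt] at this
    simp only
    linarith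

/-- If the exceedance probabilities of the level `l` over `S` sum to one, then they are the choice
probabilities over `S` of every extremal distribution. -/
lemma IsExtremal.choiceProb_eq_tail (hθ : M.IsExtremal S θ) {l : ℝ}
    (hl : ∑ i ∈ S, M.tail l i = 1) {i : Fin n} (hi : i ∈ S) :
    M.choiceProb S θ i = M.tail l i := by
  obtain ⟨θ₀, hθ₀, h₀⟩ := exists_expectedMax_eq_dualBound hl
  exact choiceProb_eq_tail_of_expectedMax_eq hθ.1
    (le_antisymm (expectedMax_le_dualBound hθ.1 ⟨i, hi⟩ l) (h₀ ▸ hθ.2 θ₀ hθ₀)) hi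

lemma exists_isExtremal (hS : S.Nonempty) {l : ℝ} (hl : ∑ i ∈ S, M.tail l i = 1) :
    ∃ θ, M.IsExtremal S θ := by
  obtain ⟨θ₀, hθ₀, h₀⟩ := exists_expectedMax_eq_dualBound hl
  exact ⟨θ₀, hθ₀, fun θ' hθ' => h₀ ▸ expectedMax_le_dualBound hθ' hS l⟩

lemma tail_eq_one_sub_cdf (l : ℝ) (i : Fin n) : M.tail l i = 1 - cdf (M.law i) (l - M.ν i) := by
  rw [cdf_eq_real, tail, ← Set.compl_Iic, probReal_compl_eq_one_sub measurableSet_Iic]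

lemma tail_antitone (i : Fin n) : Antitone fun l => M.tail l i := fun _ _ h =>
  measureReal_mono (Set.Ioi_subset_Ioi (by linarith))

lemma continuous_tail (i : Fin n) : Continuous fun l => M.tail l i := by
  simp only [tail_eq_one_sub_cdf]
  have : Continuous (cdf (M.law i)) := by
    refine continuous_iff_continuousAt.2 fun x => ?_
    rw [(cdf (M.law i)).mono.continuousAt_iff_leftLim_eq_rightLim, StieltjesFunction.rightLim_eq]
    have h := StieltjesFunction.measure_singleton (cdf (M.law i)) x
    rw [measure_cdf, measure_singleton] at h
    have h1 := ENNReal.ofReal_eq_zero.1 h.symm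
    exact le_antisymm ((cdf (M.law i)).mono.leftLim_le le_rfl) (by linarith)
  fun_prop

/-- Intermediate value theorem between the limits `S.card` and `0`. A single product is excluded:
with support unbounded below, its tail never reaches one. -/
lemma exists_sum_tail_eq_one (hS : 2 ≤ S.card) : ∃ l, ∑ i ∈ S, M.tail l i = 1 := by
  have hbot : Filter.Tendsto (fun l => ∑ i ∈ S, M.tail l i) Filter.atBot
      (nhds (∑ i ∈ S, (1 - 0))) := by
    refine tendsto_finsetSum _ fun i _ => ?_
    simp only [tail_eq_one_sub_cdf, sub_eq_add_neg _ (M.ν i)]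
    exact tendsto_const_nhds.sub ((tendsto_cdf_atBot _).comp
      (Filter.tendsto_atBot_add_const_right _ _ Filter.tendsto_id))
  have htop : Filter.Tendsto (fun l => ∑ i ∈ S, M.tail l i) Filter.atTop
      (nhds (∑ i ∈ S, (1 - 1))) := by
    refine tendsto_finsetSum _ fun i _ => ?_
    simp only [tail_eq_one_sub_cdf, sub_eq_add_neg _ (M.ν i)]
    exact tendsto_const_nhds.sub ((tendsto_cdf_atTop _).comp
      (Filter.tendsto_atTop_add_const_right _ _ Filter.tendsto_id))
  have h2 : (1 : ℝ) < ∑ i ∈ S, (1 - 0) := by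
    simp only [sub_zero, Finset.sum_const, nsmul_eq_mul, mul_one]
    exact_mod_cast hS
  obtain ⟨a, ha⟩ := (hbot.eventually_const_lt h2).exists
  obtain ⟨b, hb⟩ := (htop.eventually_lt_const (u := 1) (by simp)).exists
  have hc : Continuous fun l => ∑ i ∈ S, M.tail l i :=
    continuous_finsetSum _ fun i _ => continuous_tail i
  exact mem_range_of_exists_le_of_exists_ge hc ⟨b, hb.le⟩ ⟨a, ha.le⟩

end MDMData

/-! ### Marginal distributions with piecewise constant densities -/

/-- The measure with density `g k - g (k + 1)` on `(k, k + 1]`, for `k = 1, …, n`. -/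
noncomputable def stepLaw (n : ℕ) (g : ℕ → ℝ) : Measure ℝ :=
  ∑ k ∈ Finset.Ico 1 (n + 1),
    ENNReal.ofReal (g k - g (k + 1)) • volume.restrict (Set.Ioc (k : ℝ) (k + 1))

/-- `g` decreases strictly from `g 1 = 1` to `g (n + 1) = 0`. -/
structure IsStrictSurvival (n : ℕ) (g : ℕ → ℝ) : Prop where
  one : g 1 = 1
  last : g (n + 1) = 0
  lt : ∀ k, 1 ≤ k → k ≤ n → g (k + 1) < g k

section StepLaw

variable {n : ℕ} {g : ℕ → ℝ}

lemma sum_Ico_sub_succ (g : ℕ → ℝ) {m N : ℕ} (h : m ≤ N) :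
    ∑ k ∈ Finset.Ico m N, (g k - g (k + 1)) = g m - g N := by
  induction N, h using Nat.le_induction with
  | base => simp
  | succ N h ih => rw [Finset.sum_Ico_succ_top h, ih]; ring

lemma stepLaw_Ioi (hg : IsStrictSurvival n g) {m : ℕ} (hm : 1 ≤ m) (hmn : m ≤ n + 1) :
    stepLaw n g (Set.Ioi (m : ℝ)) = ENNReal.ofReal (g m) := by
  have hterm : ∀ k ∈ Finset.Ico 1 (n + 1),
      (ENNReal.ofReal (g k - g (k + 1)) • volume.restrict (Set.Ioc (k : ℝ) (k + 1)))
        (Set.Ioi (m : ℝ)) = if m ≤ k then ENNReal.ofReal (g k - g (k + 1)) else 0 := by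
    intro k _
    rw [Measure.smul_apply, Measure.restrict_apply measurableSet_Ioi, Set.inter_comm,
      Set.Ioc_inter_Ioi, Real.volume_Ioc]
    split_ifs with h
    · have : (m : ℝ) ≤ k := by exact_mod_cast h
      rw [sup_eq_left.2 this]
      simp
    · have : (k : ℝ) + 1 ≤ m := by exact_mod_cast not_le.1 h
      rw [sup_eq_right.2 (by linarith),
        ENNReal.ofReal_eq_zero.2 (show (k : ℝ) + 1 - m ≤ 0 by linarith)]
      simp
  rw [stepLaw, Measure.finsetSum_apply, Finset.sum_congr rfl hterm, ← Finset.sum_filter]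
  have hfilter : (Finset.Ico 1 (n + 1)).filter (fun k => m ≤ k) = Finset.Ico m (n + 1) := by
    ext k
    simp only [Finset.mem_filter, Finset.mem_Ico]
    omega
  rw [hfilter, ← ENNReal.ofReal_sum_of_nonneg, sum_Ico_sub_succ g hmn, hg.last, sub_zero]
  intro k hk
  have := Finset.mem_Ico.1 hk
  linarith [hg.lt k (by omega) (by omega)]

lemma stepLaw_compl_Icc : stepLaw n g (Set.Icc 1 (n + 1 : ℝ))ᶜ = 0 := by
  rw [stepLaw, Measure.finsetSum_apply]
  refine Finset.sum_eq_zero fun k hk => ?_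
  have hk := Finset.mem_Ico.1 hk
  have h1 : (1 : ℝ) ≤ k := by exact_mod_cast hk.1
  have h2 : (k : ℝ) + 1 ≤ n + 1 := by exact_mod_cast hk.2
  rw [Measure.smul_apply, Measure.restrict_apply measurableSet_Icc.compl]
  have : (Set.Icc 1 (n + 1 : ℝ))ᶜ ∩ Set.Ioc (k : ℝ) (k + 1) = ∅ := by
    ext t
    simp only [Set.mem_inter_iff, Set.mem_compl_iff, Set.mem_Icc, Set.mem_Ioc,
      Set.mem_empty_iff_false, iff_false, not_and, not_le]
    intro h h3
    by_contra! h4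
    linarith [h (by linarith)]
  simp [this]

lemma isProbabilityMeasure_stepLaw (hg : IsStrictSurvival n g) :
    IsProbabilityMeasure (stepLaw n g) := by
  refine ⟨?_⟩
  have h : stepLaw n g (Set.Ioi ((1 : ℕ) : ℝ)) = 1 := by
    rw [stepLaw_Ioi hg le_rfl (by omega), hg.one, ENNReal.ofReal_one]
  refine le_antisymm ?_ (h ▸ measure_mono (Set.subset_univ _))
  have h2 : ∑ k ∈ Finset.Ico 1 (n + 1), (g k - g (k + 1)) = 1 := by
    rw [sum_Ico_sub_succ g (by omega), hg.one, hg.last, sub_zero]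
  rw [stepLaw, Measure.finsetSum_apply]
  simp only [Measure.smul_apply, Measure.restrict_apply_univ, Real.volume_Ioc, smul_eq_mul,
    add_sub_cancel_left, ENNReal.ofReal_one, mul_one]
  rw [← ENNReal.ofReal_sum_of_nonneg, h2, ENNReal.ofReal_one]
  intro k hk
  have := Finset.mem_Ico.1 hk
  linarith [hg.lt k (by omega) (by omega)]

lemma stepLaw_absolutelyContinuous : stepLaw n g ≪ volume := by
  intro s hs
  rw [stepLaw, Measure.finsetSum_apply]
  refine Finset.sum_eq_zero fun k _ => ?_
  rw [Measure.smul_apply, Measure.restrict_le_self.absolutelyContinuous hs, smul_zero]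

lemma integrable_stepLaw : Integrable (fun t : ℝ => t) (stepLaw n g) := by
  rw [stepLaw, integrable_finsetSum_measure]
  intro k _
  refine Integrable.smul_measure ?_ ENNReal.ofReal_ne_top
  exact (continuous_id.integrableOn_Icc (a := (k : ℝ)) (b := k + 1)).mono_set
    Set.Ioc_subset_Icc_self

lemma stepLaw_Ioc_pos (hg : IsStrictSurvival n g) {s t : ℝ} (hs : 1 ≤ s) (hst : s < t)
    (ht : t ≤ n + 1) : 0 < stepLaw n g (Set.Ioc s t) := by
  -- Just to the right of `s` the density is that of the cell starting at `⌊s⌋₊`, which meets `(s,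
  -- t]` in an interval of positive length.
  have hk1 : 1 ≤ ⌊s⌋₊ := Nat.le_floor (by exact_mod_cast hs)
  have hks : (⌊s⌋₊ : ℝ) ≤ s := Nat.floor_le (by linarith)
  have hsk : s < ⌊s⌋₊ + 1 := Nat.lt_floor_add_one s
  have hkn : ⌊s⌋₊ < n + 1 := by
    have : (⌊s⌋₊ : ℝ) < ((n + 1 : ℕ) : ℝ) := by push_cast; linarith
    exact_mod_cast this
  set k := ⌊s⌋₊
  rw [stepLaw, Measure.finsetSum_apply]
  refine lt_of_lt_of_le ?_ (Finset.single_le_sum (f := fun k : ℕ =>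
    (ENNReal.ofReal (g k - g (k + 1)) • volume.restrict (Set.Ioc (k : ℝ) (k + 1))) (Set.Ioc s t))
    (fun _ _ => zero_le) (Finset.mem_Ico.2 ⟨hk1, hkn⟩))
  rw [Measure.smul_apply, Measure.restrict_apply measurableSet_Ioc, Set.Ioc_inter_Ioc,
    Real.volume_Ioc, sup_eq_left.2 hks, smul_eq_mul]
  refine ENNReal.mul_pos (ENNReal.ofReal_pos.2 ?_).ne' (ENNReal.ofReal_pos.2 ?_).ne'
  · linarith [hg.lt k hk1 (by omega)]
  · exact sub_pos.2 (lt_min hst hsk)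

lemma strictMonoOn_cdf_stepLaw (hg : IsStrictSurvival n g) :
    StrictMonoOn (fun t => cdf (stepLaw n g) t) (stepLaw n g).support := by
  have := isProbabilityMeasure_stepLaw hg
  have hsub : (stepLaw n g).support ⊆ Set.Icc 1 (n + 1 : ℝ) :=
    Measure.support_subset_of_isClosed isClosed_Icc (mem_ae_iff.2 stepLaw_compl_Icc)
  intro s hs t ht hst
  have hpos := stepLaw_Ioc_pos hg (hsub hs).1 hst (hsub ht).2
  have hIoc := StieltjesFunction.measure_Ioc (cdf (stepLaw n g)) s t
  rw [measure_cdf] at hIoc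
  rw [hIoc, ENNReal.ofReal_pos] at hpos
  exact sub_pos.1 hpos

end StepLaw

/-- The marginal distribution model with zero utilities and the marginals `stepLaw n (g i)`. -/
noncomputable def stepMDM {n : ℕ} (g : Fin n → ℕ → ℝ) (hg : ∀ i, IsStrictSurvival n (g i)) :
    MDMData n where
  ν := 0
  law i := stepLaw n (g i)
  isProbabilityMeasure_law i := isProbabilityMeasure_stepLaw (hg i)
  absolutelyContinuous_law _ := stepLaw_absolutelyContinuous
  strictMonoOn_cdf i := strictMonoOn_cdf_stepLaw (hg i)
  integrable_law _ := integrable_stepLaw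

lemma tail_stepMDM {n : ℕ} (g : Fin n → ℕ → ℝ) (hg : ∀ i, IsStrictSurvival n (g i)) {m : ℕ}
    (hm : 1 ≤ m) (hmn : m ≤ n) (i : Fin n) (hnn : 0 ≤ g i m) :
    (stepMDM g hg).tail m i = g i m := by
  simp only [MDMData.tail, stepMDM, Pi.zero_apply, sub_zero, measureReal_def]
  rw [stepLaw_Ioi (hg i) hm (by omega), ENNReal.toReal_ofReal hnn]

/-! ### Regular vectors -/

section Regular

variable {n : ℕ} {𝒮 : Finset (Finset (Fin n))}

/-- The vectors with simplex blocks such that `x_{i,S} ≥ x_{i,T}` for `S ⊂ T`. -/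
def regularVectors (𝒮 : Finset (Finset (Fin n))) : Set (PairIdx 𝒮 → ℝ) :=
  {x | (∀ a b : PairIdx 𝒮, a.2.1 = b.2.1 → a.1.1 ⊂ b.1.1 → x b ≤ x a) ∧
    (∀ S : {S : Finset (Fin n) // S ∈ 𝒮}, ∑ i : {i : Fin n // i ∈ S.1}, x ⟨S, i⟩ = 1) ∧
    (∀ a : PairIdx 𝒮, 0 ≤ x a)}

lemma IsNested.isLaminar (h : IsNested 𝒮) : IsLaminar 𝒮 := by
  obtain ⟨m, s, hs, hmem⟩ := h
  intro S hS T hT hST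
  obtain ⟨k, rfl⟩ := (hmem S).1 hS
  obtain ⟨l, rfl⟩ := (hmem T).1 hT
  rcases lt_trichotomy k l with h | h | h
  · exact Or.inl (hs h)
  · exact absurd (h ▸ rfl) hST
  · exact Or.inr (Or.inl (hs h))

lemma IsChoiceData.empty_notMem {p : PairIdx 𝒮 → ℝ} (hp : IsChoiceData p) : ∅ ∉ 𝒮 := by
  intro h
  have := (hp ⟨∅, h⟩).2
  simp at this

lemma block_mem_stdSimplex {x : PairIdx 𝒮 → ℝ} (hx : x ∈ regularVectors 𝒮)
    (S : {S : Finset (Fin n) // S ∈ 𝒮}) : block x S ∈ stdSimplex ℝ {i : Fin n // i ∈ S.1} :=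
  ⟨fun i => hx.2.2 ⟨S, i⟩, hx.2.1 S⟩

lemma le_one_of_mem_regularVectors {x : PairIdx 𝒮 → ℝ} (hx : x ∈ regularVectors 𝒮)
    (a : PairIdx 𝒮) : x a ≤ 1 := by
  rw [← hx.2.1 a.1]
  exact Finset.single_le_sum (f := fun i => x ⟨a.1, i⟩) (fun i _ => hx.2.2 ⟨a.1, i⟩)
    (Finset.mem_univ a.2)

/-- If `f ≤ g` on `S ⊆ T`, `f` sums to one over `S`, `g ≥ 0` sums to one over `T`, then `f = g`
on `S`. -/
lemma eqOn_of_le_of_sum_eq_one {ι : Type*} {S T : Finset ι} {f g : ι → ℝ} (hST : S ⊆ T)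
    (hle : ∀ i ∈ S, f i ≤ g i) (hg : ∀ i ∈ T, 0 ≤ g i) (hf1 : ∑ i ∈ S, f i = 1)
    (hg1 : ∑ i ∈ T, g i = 1) : ∀ i ∈ S, f i = g i := by
  have h1 : ∑ i ∈ S, g i ≤ ∑ i ∈ T, g i :=
    Finset.sum_le_sum_of_subset_of_nonneg hST fun i hi _ => hg i hi
  have h2 := Finset.sum_le_sum hle
  exact (Finset.sum_eq_sum_iff_of_le hle).1 (by linarith)

/-! ### Representable vectors are regular -/

/-- Singletons are treated apart because a level need not exist; there the argmax event is the whole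
space. -/
lemma MDMData.sum_choiceProb {M : MDMData n} {S : Finset (Fin n)} (hS : S.Nonempty)
    {θ : Measure (Fin n → ℝ)} (hθ : M.IsExtremal S θ) : ∑ i ∈ S, M.choiceProb S θ i = 1 := by
  by_cases h2 : 2 ≤ S.card
  · obtain ⟨l, hl⟩ := M.exists_sum_tail_eq_one h2
    rw [← hl]
    exact Finset.sum_congr rfl fun i hi => hθ.choiceProb_eq_tail hl hi
  · have h1 : S.card = 1 := by have := hS.card_pos; omega
    obtain ⟨i, rfl⟩ := Finset.card_eq_one.1 h1
    have := hθ.1.1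
    have huniv : {ε : Fin n → ℝ | ∀ j ∈ ({i} : Finset (Fin n)), j ≠ i →
        M.ν j + ε j < M.ν i + ε i} = Set.univ :=
      Set.eq_univ_of_forall fun ε j hj hji => absurd (Finset.mem_singleton.1 hj) hji
    rw [Finset.sum_singleton, MDMData.choiceProb, huniv, probReal_univ]

lemma MDMData.choiceProb_anti {M : MDMData n} {S T : Finset (Fin n)} (hST : S ⊆ T)
    {θS θT : Measure (Fin n → ℝ)} (hθS : M.IsExtremal S θS) (hθT : M.IsExtremal T θT)
    {i : Fin n} (hi : i ∈ S) : M.choiceProb T θT i ≤ M.choiceProb S θS i := by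
  have hθT1 := hθT.1.1
  by_cases h2 : 2 ≤ S.card
  · obtain ⟨lS, hlS⟩ := M.exists_sum_tail_eq_one h2
    obtain ⟨lT, hlT⟩ := M.exists_sum_tail_eq_one (h2.trans (Finset.card_le_card hST))
    rw [hθS.choiceProb_eq_tail hlS hi, hθT.choiceProb_eq_tail hlT (hST hi)]
    rcases le_total lS lT with h | h
    · exact MDMData.tail_antitone i h
    -- With the level of `T` below that of `S`, the tails for `T` dominate those for `S` on `S`;
    -- both families sum to one, so they agree there.
    · exact (eqOn_of_le_of_sum_eq_one hST (fun j _ => MDMData.tail_antitone j h)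
        (fun _ _ => measureReal_nonneg) hlS hlT i hi).ge
  · have hS1 : S = {i} := Finset.eq_singleton_iff_unique_mem.2
      ⟨hi, fun j hj => Finset.card_le_one.1 (by omega) j hj i hi⟩
    have h1 := MDMData.sum_choiceProb ⟨i, hi⟩ hθS
    rw [hS1, Finset.sum_singleton, ← hS1] at h1
    rw [h1]
    exact measureReal_le_one

lemma mdmRepresentable_subset_regularVectors (h𝒮 : ∅ ∉ 𝒮) :
    mdmRepresentable 𝒮 ⊆ regularVectors 𝒮 := by
  rintro x ⟨M, hM⟩
  choose θ hθ hx using hM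
  have hxa : ∀ a : PairIdx 𝒮, x a = M.choiceProb a.1.1 (θ a.1) a.2.1 := fun a => hx a.1 a.2
  refine ⟨?_, ?_, fun a => hxa a ▸ measureReal_nonneg⟩
  · rintro ⟨S, i⟩ ⟨T, j⟩ hij hST
    rw [hxa, hxa]
    simp only at hij hST ⊢
    rw [← hij]
    exact MDMData.choiceProb_anti hST.subset (hθ S) (hθ T) i.2
  · intro S
    have hne : S.1.Nonempty := Finset.nonempty_iff_ne_empty.2 fun h => h𝒮 (h ▸ S.2)
    rw [← MDMData.sum_choiceProb hne (hθ S), ← Finset.sum_coe_sort S.1]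
    exact Finset.sum_congr rfl fun i _ => hxa ⟨S, i⟩

/-! ### Regular vectors on laminar collections are limits of representable vectors -/

/-- The convex combination of `x` with the uniform choice probabilities. -/
noncomputable def mixUniform (x : PairIdx 𝒮 → ℝ) (e : ℝ) : PairIdx 𝒮 → ℝ :=
  fun a => (1 - e) * x a + e / a.1.1.card

/-- The largest `x_{i,S}` over the assortments `S` with at least `k` products. -/
noncomputable def upperEnvelope (x : PairIdx 𝒮 → ℝ) (i : Fin n) (k : ℕ) : ℝ :=
  ⨆ a : PairIdx 𝒮, if a.2.1 = i ∧ k ≤ a.1.1.card then x a else 0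

/-- A survival function for product `i` that takes the values `mixUniform x e` at the cardinalities
of the assortments. -/
noncomputable def survival (x : PairIdx 𝒮 → ℝ) (e : ℝ) (i : Fin n) (k : ℕ) : ℝ :=
  if k ≤ 1 then 1 else if n < k then 0 else (1 - e) * upperEnvelope x i k + e / k

variable {x : PairIdx 𝒮 → ℝ} {e : ℝ}

lemma upperEnvelope_nonneg (hx : x ∈ regularVectors 𝒮) (i : Fin n) (k : ℕ) :
    0 ≤ upperEnvelope x i k :=
  Real.iSup_nonneg fun a => by
    split_ifs
    exacts [hx.2.2 a, le_rfl]

lemma upperEnvelope_le_one (hx : x ∈ regularVectors 𝒮) (i : Fin n) (k : ℕ) :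
    upperEnvelope x i k ≤ 1 :=
  Real.iSup_le (fun a => by
    split_ifs
    exacts [le_one_of_mem_regularVectors hx a, zero_le_one]) zero_le_one

lemma upperEnvelope_succ_le (hx : x ∈ regularVectors 𝒮) (i : Fin n) (k : ℕ) :
    upperEnvelope x i (k + 1) ≤ upperEnvelope x i k := by
  refine Real.iSup_le (fun a => ?_) (upperEnvelope_nonneg hx i k)
  split_ifs with h
  · refine le_trans ?_ (le_ciSup (Set.finite_range _).bddAbove a)
    rw [if_pos ⟨h.1, by omega⟩]
  · exact upperEnvelope_nonneg hx i k

/-- An assortment containing product `i` meets `S`; by laminarity, if it has at least as many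
products, it is `S` or strictly contains it. Regularity then makes `x_{i,S}` the largest value. -/
lemma upperEnvelope_card (hlam : IsLaminar 𝒮) (hx : x ∈ regularVectors 𝒮) (a : PairIdx 𝒮) :
    upperEnvelope x a.2.1 a.1.1.card = x a := by
  refine le_antisymm (Real.iSup_le (fun b => ?_) (hx.2.2 a)) ?_
  · split_ifs with h
    · obtain ⟨⟨S, hS⟩, i, hi⟩ := a
      obtain ⟨⟨T, hT⟩, j, hj⟩ := b
      obtain ⟨h1, h2⟩ := h
      simp only at h1 h2
      subst h1
      by_cases hST : S = T
      · subst hST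
        exact le_rfl
      · rcases hlam S hS T hT hST with h | h | h
        · exact hx.1 _ _ rfl h
        · exact absurd (Finset.card_lt_card h) (by omega)
        · exact absurd (Finset.mem_inter.2 ⟨hi, hj⟩) (by simp [h])
    · exact hx.2.2 a
  · refine le_trans ?_ (le_ciSup (Set.finite_range _).bddAbove a)
    rw [if_pos ⟨rfl, le_rfl⟩]

lemma isStrictSurvival_survival (hx : x ∈ regularVectors 𝒮) (he : 0 < e) (he1 : e < 1)
    (i : Fin n) : IsStrictSurvival n (survival x e i) where
  one := by simp [survival]
  last := by
    have := i.pos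
    simp [survival, show ¬ n + 1 ≤ 1 by omega]
  lt k hk hkn := by
    have hk0 : (0 : ℝ) < k := by exact_mod_cast hk
    -- The envelope decreases only weakly; strictness comes from the uniform part `e / k`.
    have hpos : e / ((k : ℝ) + 1) < e / k := div_lt_div_of_pos_left he hk0 (by linarith)
    have hE := mul_le_mul_of_nonneg_left (upperEnvelope_succ_le hx i k) (sub_nonneg.2 he1.le)
    have hE0 := mul_nonneg (sub_nonneg.2 he1.le) (upperEnvelope_nonneg hx i (k + 1))
    have hE1 := mul_le_mul_of_nonneg_left (upperEnvelope_le_one hx i (k + 1))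
      (sub_nonneg.2 he1.le)
    have hd : 0 < e / (k : ℝ) := div_pos he hk0
    rcases hk.eq_or_lt with rfl | hk1
    · simp only [survival, le_refl, if_true]
      simp only [Nat.cast_one, div_one] at hpos
      split_ifs
      · omega
      · norm_num
      · push_cast
        linarith
    · simp only [survival, show ¬ k + 1 ≤ 1 by omega, show ¬ k ≤ 1 by omega,
        show ¬ n < k by omega, if_false]
      split_ifs
      · linarith
      · push_cast
        linarith

lemma survival_card (hlam : IsLaminar 𝒮) (hx : x ∈ regularVectors 𝒮) (a : PairIdx 𝒮) :
    survival x e a.2.1 a.1.1.card = mixUniform x e a := by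
  have hn : ¬ n < a.1.1.card := by
    have := card_finset_fin_le a.1.1
    omega
  have hpos : 0 < a.1.1.card := Finset.card_pos.2 ⟨_, a.2.2⟩
  simp only [survival, hn, if_false, mixUniform, upperEnvelope_card hlam hx]
  split_ifs with h
  -- The prescribed value `1` at cardinality one is consistent: a singleton assortment has `x a =
  -- 1`, hence mixture `(1 - e) + e`.
  · have h1 : a.1.1.card = 1 := by omega
    have hss : Subsingleton {i : Fin n // i ∈ a.1.1} :=
      Fintype.card_le_one_iff_subsingleton.1 (by simp [h1])
    have hxa : x a = 1 := by
      have := hx.2.1 a.1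
      rwa [Fintype.sum_subsingleton _ a.2] at this
    rw [h1, hxa]
    simp
  · rfl

lemma sum_mixUniform (h𝒮 : ∅ ∉ 𝒮) (hx : x ∈ regularVectors 𝒮)
    (S : {S : Finset (Fin n) // S ∈ 𝒮}) :
    ∑ i : {i : Fin n // i ∈ S.1}, mixUniform x e ⟨S, i⟩ = 1 := by
  have hne : S.1.Nonempty := Finset.nonempty_iff_ne_empty.2 fun h => h𝒮 (h ▸ S.2)
  have hc : (S.1.card : ℝ) ≠ 0 := by exact_mod_cast hne.card_pos.ne'
  simp only [mixUniform]
  rw [Finset.sum_add_distrib, ← Finset.mul_sum, hx.2.1 S]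
  simp only [Finset.sum_const, Finset.card_univ, Fintype.card_coe, nsmul_eq_mul]
  field_simp
  ring

lemma mixUniform_mem_mdmRepresentable (hlam : IsLaminar 𝒮) (h𝒮 : ∅ ∉ 𝒮)
    (hx : x ∈ regularVectors 𝒮) (he : 0 < e) (he1 : e < 1) :
    mixUniform x e ∈ mdmRepresentable 𝒮 := by
  have hg := isStrictSurvival_survival hx he he1
  refine ⟨stepMDM (survival x e) hg, fun S => ?_⟩
  have hne : S.1.Nonempty := Finset.nonempty_iff_ne_empty.2 fun h => h𝒮 (h ▸ S.2)
  have htail : ∀ i : {i : Fin n // i ∈ S.1},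
      (stepMDM (survival x e) hg).tail S.1.card i.1 = mixUniform x e ⟨S, i⟩ := by
    intro i
    have h := survival_card (e := e) hlam hx ⟨S, i⟩
    rw [← h]
    refine tail_stepMDM _ hg hne.card_pos (card_finset_fin_le S.1) i.1 ?_
    rw [h]
    have := mul_nonneg (sub_nonneg.2 he1.le) (hx.2.2 ⟨S, i⟩)
    have : 0 ≤ e / (S.1.card : ℝ) := by positivity
    simp only [mixUniform]
    linarith
  have hl : ∑ i ∈ S.1, (stepMDM (survival x e) hg).tail S.1.card i = 1 := by
    rw [← Finset.sum_coe_sort, ← sum_mixUniform (e := e) h𝒮 hx S]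
    exact Finset.sum_congr rfl fun i _ => htail i
  obtain ⟨θ, hθ⟩ := MDMData.exists_isExtremal hne hl
  exact ⟨θ, hθ, fun i => by rw [hθ.choiceProb_eq_tail hl i.2, htail, block]⟩

/-! ### The limit as a minimum over the regular vectors -/

lemma continuousOn_totalLoss {loss : LossFamily n} {p : PairIdx 𝒮 → ℝ}
    (hcont : ∀ S : {S : Finset (Fin n) // S ∈ 𝒮},
      ContinuousOn (loss S.1 (block p S)) (stdSimplex ℝ {i : Fin n // i ∈ S.1})) :
    ContinuousOn (totalLoss loss p) (regularVectors 𝒮) := by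
  refine continuousOn_finsetSum _ fun S _ => ?_
  refine (hcont S).comp (f := fun x : PairIdx 𝒮 → ℝ => block x S) ?_
    fun x hx => block_mem_stdSimplex hx S
  exact Continuous.continuousOn (continuous_pi fun i => continuous_apply _)

lemma mdmLimit_le_totalLoss {loss : LossFamily n} {p : PairIdx 𝒮 → ℝ}
    (hlam : IsLaminar 𝒮) (h𝒮 : ∅ ∉ 𝒮)
    (hcont : ∀ S : {S : Finset (Fin n) // S ∈ 𝒮},
      ContinuousOn (loss S.1 (block p S)) (stdSimplex ℝ {i : Fin n // i ∈ S.1}))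
    (hx : x ∈ regularVectors 𝒮) : mdmLimit loss p ≤ totalLoss loss p x := by
  have hmem : ∀ᶠ e in nhdsWithin (0 : ℝ) (Set.Ioi 0), mixUniform x e ∈ mdmRepresentable 𝒮 := by
    filter_upwards [Ioo_mem_nhdsGT (zero_lt_one' ℝ)] with e he
    exact mixUniform_mem_mdmRepresentable hlam h𝒮 hx he.1 he.2
  have htend : Filter.Tendsto (fun e => mixUniform x e) (nhdsWithin (0 : ℝ) (Set.Ioi 0))
      (nhds x) := by
    have hc : Continuous fun e => mixUniform x e := by
      unfold mixUniform
      fun_prop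
    have h0 : mixUniform x 0 = x := by
      funext a
      simp [mixUniform]
    have := hc.tendsto 0
    rw [h0] at this
    exact this.mono_left nhdsWithin_le_nhds
  -- The loss is continuous only on the regular set, so the approximants must be known to lie in it.
  have h := (continuousOn_totalLoss hcont x hx).tendsto.comp
    (tendsto_nhdsWithin_iff.2
      ⟨htend, hmem.mono fun e he => mdmRepresentable_subset_regularVectors h𝒮 he⟩)
  exact ge_of_tendsto h (hmem.mono fun e he => iInf₂_le _ he)

lemma isCompact_regularVectors : IsCompact (regularVectors 𝒮) := by
  refine IsCompact.of_isClosed_subset (isCompact_univ_pi fun _ : PairIdx 𝒮 =>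
    isCompact_Icc (a := (0 : ℝ)) (b := 1)) ?_
    fun x hx a _ => ⟨hx.2.2 a, le_one_of_mem_regularVectors hx a⟩
  have h : regularVectors 𝒮 =
      (⋂ a : PairIdx 𝒮, ⋂ b : PairIdx 𝒮, ⋂ _ : a.2.1 = b.2.1, ⋂ _ : a.1.1 ⊂ b.1.1,
        {x | x b ≤ x a}) ∩
      ((⋂ S : {S : Finset (Fin n) // S ∈ 𝒮}, {x | ∑ i : {i : Fin n // i ∈ S.1}, x ⟨S, i⟩ = 1}) ∩
        ⋂ a : PairIdx 𝒮, {x | 0 ≤ x a}) := by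
    ext x
    simp only [regularVectors, Set.mem_inter_iff, Set.mem_iInter, Set.mem_ofPred_eq]
  rw [h]
  refine IsClosed.inter ?_ (IsClosed.inter ?_ ?_)
  · exact isClosed_iInter fun a => isClosed_iInter fun b => isClosed_iInter fun _ =>
      isClosed_iInter fun _ => isClosed_le (continuous_apply b) (continuous_apply a)
  · exact isClosed_iInter fun S => isClosed_eq (by fun_prop) continuous_const
  · exact isClosed_iInter fun a => isClosed_le continuous_const (continuous_apply a)

lemma regularVectors_nonempty (h𝒮 : ∅ ∉ 𝒮) : (regularVectors 𝒮).Nonempty := by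
  refine ⟨fun a => 1 / a.1.1.card, ?_, ?_, fun a => by positivity⟩
  · intro a b _ hab
    exact one_div_le_one_div_of_le (by exact_mod_cast Finset.card_pos.2 ⟨_, a.2.2⟩)
      (by exact_mod_cast Finset.card_le_card hab.subset)
  · intro S
    have hne : S.1.Nonempty := Finset.nonempty_iff_ne_empty.2 fun h => h𝒮 (h ▸ S.2)
    have hc : (S.1.card : ℝ) ≠ 0 := by exact_mod_cast hne.card_pos.ne'
    simp [hc]

lemma isLeast_mdmLimit_regularVectors {loss : LossFamily n} {p : PairIdx 𝒮 → ℝ}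
    (hlam : IsLaminar 𝒮) (h𝒮 : ∅ ∉ 𝒮)
    (hcont : ∀ S : {S : Finset (Fin n) // S ∈ 𝒮},
      ContinuousOn (loss S.1 (block p S)) (stdSimplex ℝ {i : Fin n // i ∈ S.1})) :
    IsLeast (totalLoss loss p '' regularVectors 𝒮) (mdmLimit loss p) := by
  obtain ⟨x, hx, hmin⟩ := isCompact_regularVectors.exists_isMinOn (regularVectors_nonempty h𝒮)
    (continuousOn_totalLoss hcont)
  refine ⟨⟨x, hx, le_antisymm (le_iInf₂ fun y hy => ?_)
    (mdmLimit_le_totalLoss hlam h𝒮 hcont hx)⟩, ?_⟩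
  · exact hmin (mdmRepresentable_subset_regularVectors h𝒮 hy)
  · rintro _ ⟨y, hy, rfl⟩
    exact mdmLimit_le_totalLoss hlam h𝒮 hcont hy

/-- On a laminar collection the regular vectors are the first components of the feasible pairs of
the general program. -/
lemma image_fst_rankingFeasible (hlam : IsLaminar 𝒮) :
    Prod.fst '' rankingFeasible 𝒮 = regularVectors 𝒮 := by
  ext x
  constructor
  · rintro ⟨⟨x, l⟩, ⟨h1, h2, h3⟩, rfl⟩
    refine ⟨?_, h2, h3⟩
    rintro ⟨S, i⟩ ⟨T, j⟩ hij hST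
    rcases le_total (l S) (l T) with h | h
    · exact h1 _ _ hij h
    -- In the reverse order the ranking constraint gives `x_S ≤ x_T` on `S`, and normalization turns
    -- this into equality. The default value of `f` outside the assortment plays no role.
    · classical
      let f : {S : Finset (Fin n) // S ∈ 𝒮} → Fin n → ℝ := fun S i =>
        if hi : i ∈ S.1 then x ⟨S, i, hi⟩ else 0
      have hsum : ∀ S, ∑ i ∈ S.1, f S i = 1 := by
        intro S
        rw [← Finset.sum_coe_sort, ← h2 S]
        exact Finset.sum_congr rfl fun i _ => dif_pos i.2
      have hf := eqOn_of_le_of_sum_eq_one (f := f S) (g := f T) hST.subset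
        (fun k hk => by
          simp only [f, hk, hST.subset hk, dif_pos]
          exact h1 ⟨T, k, hST.subset hk⟩ ⟨S, k, hk⟩ rfl h)
        (fun k hk => by simp only [f, hk, dif_pos]; exact h3 _) (hsum S) (hsum T) i.1 i.2
      simp only at hij
      simp only [f, i.2, hST.subset i.2, dif_pos] at hf
      obtain ⟨j, hj⟩ := j
      simp only at hij
      subst hij
      exact hf.ge
  · intro hx
    -- Ranking by cardinality: for laminar assortments with a common product, a weakly larger
    -- cardinality means containment.
    refine ⟨(x, fun S => S.1.card), ⟨?_, hx.2.1, hx.2.2⟩, rfl⟩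
    rintro ⟨⟨S, hS⟩, i, hi⟩ ⟨⟨T, hT⟩, j, hj⟩ hij hle
    simp only at hij hle
    subst hij
    have hcard : S.card ≤ T.card := by exact_mod_cast hle
    by_cases hST : S = T
    · subst hST
      exact le_rfl
    · rcases hlam S hS T hT hST with h | h | h
      · exact hx.1 _ _ rfl h
      · exact absurd (Finset.card_lt_card h) (by omega)
      · exact absurd (Finset.mem_inter.2 ⟨hi, hj⟩) (by simp [h])

/-! ### The regularity program -/

lemma mem_feasible_regularityProgram_iff {loss : LossFamily n} {p : PairIdx 𝒮 → ℝ} :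
    x ∈ (regularityProgram loss p).feasible ↔ x ∈ regularVectors 𝒮 := by
  have h : x ∈ (regularityProgram loss p).feasible ↔
      ∀ c, (regularityConstraint 𝒮 c).Holds x :=
    ⟨fun h c => by
      have h1 : (regularityConstraint 𝒮 ((Fintype.equivFin (RegularityConstraintIdx 𝒮)).symm
        (Fintype.equivFin (RegularityConstraintIdx 𝒮) c))).Holds x := h _
      rwa [Equiv.symm_apply_apply] at h1, fun h _ => h _⟩
  rw [h]
  have hge : ∀ t : RegularityIdx 𝒮, (regularityConstraint 𝒮 (.inl t)).Holds x ↔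
      x t.1.2 ≤ x t.1.1 := by
    intro t
    simp [regularityConstraint, LinConstraint.Holds, sub_mul, Finset.sum_sub_distrib,
      Pi.single_apply]
  have heq : ∀ S, (regularityConstraint 𝒮 (.inr (.inl S))).Holds x ↔
      ∑ i : {i : Fin n // i ∈ S.1}, x ⟨S, i⟩ = 1 := by
    intro S
    simp only [regularityConstraint, LinConstraint.Holds, Fintype.sum_sigma, ite_mul, one_mul,
      zero_mul]
    rw [Finset.sum_eq_single S (fun T _ hT => by simp [hT]) (by simp)]
    simp
  have hnn : ∀ a, (regularityConstraint 𝒮 (.inr (.inr a))).Holds x ↔ 0 ≤ x a := by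
    intro a
    simp [regularityConstraint, LinConstraint.Holds, Pi.single_apply]
  rw [Sum.forall, Sum.forall]
  simp only [hge, heq, hnn]
  refine and_congr ⟨fun h a b hab hlt => h ⟨(a, b), hab, hlt⟩, fun h t => h _ _ t.2.1 t.2.2⟩ Iff.rfl

lemma convex_regularVectors : Convex ℝ (regularVectors 𝒮) := by
  intro x hx y hy a b ha hb hab
  refine ⟨fun s t hst hlt => ?_, fun S => ?_, fun s => ?_⟩
  · simp only [Pi.add_apply, Pi.smul_apply, smul_eq_mul]
    exact add_le_add (mul_le_mul_of_nonneg_left (hx.1 s t hst hlt) ha)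
      (mul_le_mul_of_nonneg_left (hy.1 s t hst hlt) hb)
  · simp only [Pi.add_apply, Pi.smul_apply, smul_eq_mul, Finset.sum_add_distrib,
      ← Finset.mul_sum, hx.2.1 S, hy.2.1 S, mul_one, hab]
  · exact add_nonneg (mul_nonneg ha (hx.2.2 s)) (mul_nonneg hb (hy.2.2 s))

lemma convexOn_totalLoss {loss : LossFamily n} {p : PairIdx 𝒮 → ℝ}
    (hconv : ∀ S : {S : Finset (Fin n) // S ∈ 𝒮},
      ConvexOn ℝ≥0 (stdSimplex ℝ {i : Fin n // i ∈ S.1}) (loss S.1 (block p S))) :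
    ConvexOn ℝ≥0 (regularVectors 𝒮) (totalLoss loss p) := by
  refine ⟨fun x hx y hy a b ha hb hab => ?_, fun x hx y hy a b ha hb hab => ?_⟩
  · exact convex_regularVectors hx hy a.2 b.2 (by exact_mod_cast hab)
  · simp only [totalLoss, Finset.smul_sum, ← Finset.sum_add_distrib]
    exact Finset.sum_le_sum fun S _ => (hconv S).2 (block_mem_stdSimplex hx S)
      (block_mem_stdSimplex hy S) ha hb hab

lemma card_pairIdx_le : Fintype.card (PairIdx 𝒮) ≤ n * 𝒮.card := by
  have h : Function.Injective
      (fun a : PairIdx 𝒮 => ((a.2.1, a.1) : Fin n × {S : Finset (Fin n) // S ∈ 𝒮})) := by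
    rintro ⟨S, i, hi⟩ ⟨T, j, hj⟩ h
    simp only [Prod.mk.injEq] at h
    obtain ⟨rfl, rfl⟩ := h
    rfl
  simpa using Fintype.card_le_of_injective _ h

/-- Both kinds of constraints inject into triples of a product and two assortments: non-negativity
uses the diagonal triples, regularity only off-diagonal ones. -/
lemma card_regularityIdx_add_card_pairIdx_le :
    Fintype.card (RegularityIdx 𝒮) + Fintype.card (PairIdx 𝒮) ≤ n * 𝒮.card ^ 2 := by
  have h : Function.Injective (Sum.elim
      (fun t : RegularityIdx 𝒮 => (t.1.1.2.1, t.1.1.1, t.1.2.1))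
      (fun a : PairIdx 𝒮 =>
        ((a.2.1, a.1, a.1) : Fin n × {S : Finset (Fin n) // S ∈ 𝒮} ×
          {S : Finset (Fin n) // S ∈ 𝒮}))) := by
    refine Function.Injective.sumElim ?_ ?_ ?_
    · rintro ⟨⟨⟨S, i, hi⟩, ⟨T, j, hj⟩⟩, hij, hST⟩ ⟨⟨⟨S', i', hi'⟩, ⟨T', j', hj'⟩⟩, hij', hST'⟩ h
      simp only [Prod.mk.injEq] at h hij hij'
      obtain ⟨rfl, rfl, rfl⟩ := h
      subst hij
      subst hij'
      rfl
    · rintro ⟨S, i, hi⟩ ⟨T, j, hj⟩ h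
      simp only [Prod.mk.injEq] at h
      obtain ⟨rfl, rfl, -⟩ := h
      rfl
    · rintro ⟨⟨a, b⟩, hab, hlt⟩ c h
      simp only [Prod.mk.injEq] at h
      simp only [h.2.1, h.2.2, ssubset_irrefl] at hlt
  have hcard := Fintype.card_le_of_injective _ h
  simp only [Fintype.card_sum, Fintype.card_prod, Fintype.card_fin, Fintype.card_coe] at hcard
  simpa [sq] using hcard

/-- Absorbs the normalization constraints into the count; a nonempty assortment ensures `n ≥ 1`. -/
lemma card_le_of_empty_notMem (h𝒮 : ∅ ∉ 𝒮) : 𝒮.card ≤ n * 𝒮.card ^ 2 := by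
  rcases 𝒮.eq_empty_or_nonempty with rfl | ⟨S, hS⟩
  · simp
  · obtain ⟨i, -⟩ : S.Nonempty := Finset.nonempty_iff_ne_empty.2 fun h => h𝒮 (h ▸ hS)
    exact (Nat.le_self_pow two_ne_zero _).trans (Nat.le_mul_of_pos_left _ i.pos)

lemma regularityConstraint_coeff_rhs_mem (c : RegularityConstraintIdx 𝒮) :
    (∀ a, (regularityConstraint 𝒮 c).coeff a ∈ ({-1, 0, 1} : Set ℝ)) ∧
      (regularityConstraint 𝒮 c).rhs ∈ ({-1, 0, 1} : Set ℝ) := by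
  rcases c with t | S | b
  · refine ⟨fun a => ?_, by simp [regularityConstraint, LinConstraint.rhs]⟩
    simp only [regularityConstraint, LinConstraint.coeff, Pi.sub_apply, Pi.single_apply]
    split_ifs <;> simp
  · refine ⟨fun a => ?_, by simp [regularityConstraint, LinConstraint.rhs]⟩
    simp only [regularityConstraint, LinConstraint.coeff]
    split_ifs <;> simp
  · refine ⟨fun a => ?_, by simp [regularityConstraint, LinConstraint.rhs]⟩
    simp only [regularityConstraint, LinConstraint.coeff, Pi.single_apply]
    split_ifs <;> simp

end Regular

theorem corollary2 (n : ℕ) (𝒮 : Finset (Finset (Fin n))) (h𝒮 : IsNested 𝒮 ∨ IsLaminar 𝒮)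
    (p : PairIdx 𝒮 → ℝ) (hp : IsChoiceData p) (loss : LossFamily n)
    (hconv : ∀ S : {S : Finset (Fin n) // S ∈ 𝒮},
      ConvexOn ℝ≥0 (stdSimplex ℝ {i : Fin n // i ∈ S.1}) (loss S.1 (block p S)))
    (hcont : ∀ S : {S : Finset (Fin n) // S ∈ 𝒮},
      ContinuousOn (loss S.1 (block p S)) (stdSimplex ℝ {i : Fin n // i ∈ S.1})) :
    -- the limit of MDM is the attained optimal value of the regularity program
    (regularityProgram loss p).HasMin (mdmLimit loss p) ∧
    -- it is also the attained optimal value of the general program over `(x, lam)`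
    IsLeast ((fun q => totalLoss loss p q.1) '' rankingFeasible 𝒮) (mdmLimit loss p) ∧
    -- the regularity program is convex
    (regularityProgram loss p).IsConvex ∧
    -- its feasible region is cut out by the regularity and the simplex constraints alone
    (∀ x : PairIdx 𝒮 → ℝ, x ∈ (regularityProgram loss p).feasible ↔
      (∀ a b : PairIdx 𝒮, a.2.1 = b.2.1 → a.1.1 ⊂ b.1.1 → x b ≤ x a) ∧
      (∀ S : {S : Finset (Fin n) // S ∈ 𝒮}, ∑ i : {i : Fin n // i ∈ S.1}, x ⟨S, i⟩ = 1) ∧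
      (∀ a : PairIdx 𝒮, 0 ≤ x a)) ∧
    -- `O(n |𝒮|)` variables
    Fintype.card (PairIdx 𝒮) ≤ n * 𝒮.card ∧
    -- `O(n |𝒮|²)` linear constraints, with coefficients and right-hand sides in `{-1, 0, 1}`
    (regularityProgram loss p).numConstraints ≤ 2 * (n * 𝒮.card ^ 2) ∧
    (∀ k, (∀ a, ((regularityProgram loss p).constraint k).coeff a ∈ ({-1, 0, 1} : Set ℝ)) ∧
      ((regularityProgram loss p).constraint k).rhs ∈ ({-1, 0, 1} : Set ℝ)) := by
  have hlam : IsLaminar 𝒮 := h𝒮.elim IsNested.isLaminar id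
  have hempty : ∅ ∉ 𝒮 := hp.empty_notMem
  have hfeas : (regularityProgram loss p).feasible = regularVectors 𝒮 :=
    Set.ext fun _ => mem_feasible_regularityProgram_iff
  have hleast := isLeast_mdmLimit_regularVectors hlam hempty hcont
  refine ⟨?_, ?_, ⟨?_, ?_⟩, fun _ => mem_feasible_regularityProgram_iff, card_pairIdx_le, ?_,
    fun _ => regularityConstraint_coeff_rhs_mem _⟩
  · rw [LinConstrainedProgram.HasMin, hfeas]
    exact hleast
  · rw [← image_fst_rankingFeasible hlam, Set.image_image] at hleast
    exact hleast
  · rw [hfeas]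
    exact convex_regularVectors
  · rw [hfeas]
    exact convexOn_totalLoss hconv
  · have h1 := card_regularityIdx_add_card_pairIdx_le (𝒮 := 𝒮)
    have h2 := card_le_of_empty_notMem hempty
    simp only [regularityProgram, Fintype.card_sum, Fintype.card_coe] at h1 ⊢
    omega
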